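/- Let $\alpha,\beta>0$ and let $$B^{(\alpha,\beta)}(z,w)=(1-z_1\bar w_1)^{-\alpha}(1-z_2\bar w_2)^{-\beta},\qquad z=(z_1,z_2),\ w=(w_1,w_2)\in\mathbb D^2,$$ (principal powers) be the reproducing kernel of the Hilbert space $\mathcal H$ of holomorphic functions on the bidisc. Let $J^{(2)}\mathcal H_{|\mathrm{res}\,\triangle}$ be the Hilbert space of $\mathbb C^2$-valued holomorphic functions on the unit disc $\mathbb D$ whose reproducing kernel is the restriction to the diagonal $\triangle=\{(z,z):z\in\mathbb D\}$ of the jet kernel of $B^{(\alpha,\beta)}$, that is, $$J^{(2)}B^{(\alpha,\beta)}(z,w)=\Big(\partial_{z_2}^{\,i}\,\bar\partial_{w_2}^{\,j}B^{(\alpha,\beta)}\big((z_1,z_2),(w_1,w_2)\big)\Big|_{z_1=z_2=z,\;w_1=w_2=w}\Big)_{i,j=0}^{1},\qquad z,w\in\mathbb D .$$ Then this Hilbert space exists (the kernel is non-negative definite), the multiplication operator $(Mf)(z)=zf(z)$ is bounded on it, and its adjoint $M^*$ is irreducible: the space is nonzero, and the only closed subspaces $S$ such that both $S$ and $S^\perp$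 are invariant under $M^*$ are $0$ and the whole space. -/

import Mathlib

open scoped ComplexConjugate

noncomputable section

/-- The kernel `B^{(α,β)}(z,w) = (1 - z₁ w̄₁)^{-α} (1 - z₂ w̄₂)^{-β}` of the bidisc.  For `z, w` in
the bidisc both bases lie in the open right half plane, and the powers are principal. -/
def bidiscKernel (α β : ℝ) (z w : ℂ × ℂ) : ℂ :=
  (1 - z.1 * conj w.1) ^ (-(α : ℂ)) * (1 - z.2 * conj w.2) ^ (-(β : ℂ))

/-- The `k × k` matrix with `(i, j)` entry `∂₂^i ∂̄₂^j K (z, w)`, for a kernel `K` that is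
holomorphic in `z` and antiholomorphic in `w`: `∂₂^i` differentiates `i` times in the second
coordinate of `z`, and `∂̄₂^j` differentiates `j` times in the conjugate of the second coordinate
of `w`, using `∂̄^j g = conj (∂^j (conj g))`. -/
def jetMatrix (k : ℕ) (K : ℂ × ℂ → ℂ × ℂ → ℂ) (z w : ℂ × ℂ) : Matrix (Fin k) (Fin k) ℂ :=
  Matrix.of fun i j =>
    conj (iteratedDeriv j
      (fun w₂ => conj (iteratedDeriv i (fun z₂ => K (z.1, z₂) (w.1, w₂)) z.2)) w.2)

/-- The restriction of the jet kernel `J^{(k)}K` to the diagonal of the bidisc, as an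
operator-valued kernel on the unit disc. -/
def diagJetKernel (k : ℕ) (K : ℂ × ℂ → ℂ × ℂ → ℂ) :
    Matrix Complex.UnitDisc Complex.UnitDisc
      (EuclideanSpace ℂ (Fin k) →L[ℂ] EuclideanSpace ℂ (Fin k)) :=
  Matrix.of fun z w =>
    Matrix.toEuclideanCLM (n := Fin k) (𝕜 := ℂ)
      (jetMatrix k K ((z : ℂ), (z : ℂ)) ((w : ℂ), (w : ℂ)))

/-- A bounded operator on a nonzero Hilbert space is irreducible if it is not the orthogonal
direct sum of two operators on nonzero spaces: a closed subspace that is invariant together with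
its orthogonal complement is trivial. -/
def IsIrreducibleOperator {H : Type*} [NormedAddCommGroup H] [InnerProductSpace ℂ H]
    (T : H →L[ℂ] H) : Prop :=
  Nontrivial H ∧ ∀ S : Submodule ℂ H, IsClosed (S : Set H) →
    (∀ x ∈ S, T x ∈ S) → (∀ x ∈ Sᗮ, T x ∈ Sᗮ) → S = ⊥ ∨ S = ⊤

end

open scoped InnerProductSpace ENNReal

/-! ### Reducing subspaces of an operator that shifts two sequences. -/

section Reducing

variable {H : Type*} [NormedAddCommGroup H] [InnerProductSpace ℂ H]

/-! Put `p = α + β`. The diagonal jet kernel equals that of the pairs `(f, (β/p) f' + s g)`, where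
`s² = αβ/p` and `f`, `g` range over the spaces with kernels `(1 - z w̄)^(-p)` and `(1 - z
w̄)^(-p-2)`. This gives an explicit model on `ℓ² ⊕ ℓ²` (`inner_bidiscFeature`), in which
multiplication by `z` is two bounded weighted shifts plus a bounded inclusion
(`exists_clm_jetFeature_eigenvector`). Any space with this kernel is unitarily equivalent to the
model.

For irreducibility, let `pₙ = (zⁿ, 0)` and `rₙ = (zⁿ⁺¹, zⁿ)`. They are total, `M` shifts both, and
`p₀`, `r₀` span the kernel of `M*`. The projection `P` onto a reducing subspace commutes with `M`,
so it is given on every pair `(pₙ, rₙ)` by one and the same 2 × 2 matrix. Self-adjointness of `P`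
against the Gram entries of low degree makes that matrix scalar, so `P` is `0` or `1`
(`isIrreducibleOperator_adjoint_of_shift`). -/

lemma starProjection_apply_comm_of_reducing_adjoint [CompleteSpace H] (M : H →L[ℂ] H) (S : Submodule ℂ H)
    [S.HasOrthogonalProjection]
    (h₁ : ∀ x ∈ S, ContinuousLinearMap.adjoint M x ∈ S)
    (h₂ : ∀ x ∈ Sᗮ, ContinuousLinearMap.adjoint M x ∈ Sᗮ) (f : H) :
    S.starProjection (M f) = M (S.starProjection f) := by
  -- Applying `M*` to `g = Pg + (g - Pg)` keeps each summand in its subspace, so `P` commutes with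
  -- `M*`; taking adjoints gives the same for `M`.
  have key : ∀ g, S.starProjection (ContinuousLinearMap.adjoint M g) =
      ContinuousLinearMap.adjoint M (S.starProjection g) := by
    intro g
    refine Submodule.eq_starProjection_of_mem_of_inner_eq_zero
      (h₁ _ (S.starProjection_apply_mem g)) ?_
    intro w hw
    rw [← map_sub]
    have := h₂ _ (S.sub_starProjection_mem_orthogonal g)
    exact (Submodule.mem_orthogonal' S _).1 this w hw
  refine ext_inner_left ℂ fun g => ?_
  rw [← Submodule.inner_starProjection_left_eq_right, ← ContinuousLinearMap.adjoint_inner_left,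
    ← ContinuousLinearMap.adjoint_inner_left, ← key, Submodule.inner_starProjection_left_eq_right]

/-- Removing from `x` its components along `p 0` and `r 0` leaves a vector orthogonal to these two
and to the range of `M`, hence to all `p n` and `r n`. -/
lemma eq_smul_add_smul_of_orthogonal_range {M : H →L[ℂ] H} {p r : ℕ → H}
    (hp : ∀ n, M (p n) = p (n + 1)) (hr : ∀ n, M (r n) = r (n + 1))
    (hspan : ∀ f, (∀ n, ⟪p n, f⟫_ℂ = 0) → (∀ n, ⟪r n, f⟫_ℂ = 0) → f = 0)
    (hp0 : ∀ f, ⟪p 0, M f⟫_ℂ = 0) (hr0 : ∀ f, ⟪r 0, M f⟫_ℂ = 0)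
    (h00 : ⟪p 0, r 0⟫_ℂ = 0) (hp' : p 0 ≠ 0) (hr' : r 0 ≠ 0)
    {x : H} (hx : ∀ f, ⟪x, M f⟫_ℂ = 0) : ∃ A B : ℂ, x = A • p 0 + B • r 0 := by
  have hpp : ⟪p 0, p 0⟫_ℂ ≠ 0 := inner_self_ne_zero.2 hp'
  have hrr : ⟪r 0, r 0⟫_ℂ ≠ 0 := inner_self_ne_zero.2 hr'
  have h00' : ⟪r 0, p 0⟫_ℂ = 0 := inner_eq_zero_symm.1 h00
  have hM : ∀ f, ⟪M f, x - ((⟪p 0, x⟫_ℂ / ⟪p 0, p 0⟫_ℂ) • p 0 +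
      (⟪r 0, x⟫_ℂ / ⟪r 0, r 0⟫_ℂ) • r 0)⟫_ℂ = 0 := by
    intro f
    rw [inner_sub_right, inner_add_right, inner_smul_right, inner_smul_right,
      inner_eq_zero_symm.1 (hx f), inner_eq_zero_symm.1 (hp0 f), inner_eq_zero_symm.1 (hr0 f)]
    simp
  refine ⟨⟪p 0, x⟫_ℂ / ⟪p 0, p 0⟫_ℂ, ⟪r 0, x⟫_ℂ / ⟪r 0, r 0⟫_ℂ, sub_eq_zero.1 (hspan _ ?_ ?_)⟩
  · rintro (_ | n)
    · rw [inner_sub_right, inner_add_right, inner_smul_right, inner_smul_right, h00]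
      field_simp
      simp
    · rw [← hp]; exact hM _
  · rintro (_ | n)
    · rw [inner_sub_right, inner_add_right, inner_smul_right, inner_smul_right, h00']
      field_simp
      simp
    · rw [← hr]; exact hM _

/-- If `M` shifts two sequences whose union is total and whose initial terms are orthogonal to the
range of `M`, then a few conditions on their Gram matrix force `M*` to be irreducible. -/
lemma isIrreducibleOperator_adjoint_of_shift [CompleteSpace H] (M : H →L[ℂ] H) (p r : ℕ → H)
    (hp : ∀ n, M (p n) = p (n + 1)) (hr : ∀ n, M (r n) = r (n + 1))
    (hspan : ∀ f, (∀ n, ⟪p n, f⟫_ℂ = 0) → (∀ n, ⟪r n, f⟫_ℂ = 0) → f = 0)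
    (hp0 : ∀ f, ⟪p 0, M f⟫_ℂ = 0) (hr0 : ∀ f, ⟪r 0, M f⟫_ℂ = 0)
    (h00 : ⟪p 0, r 0⟫_ℂ = 0) (h11 : ⟪p 1, r 1⟫_ℂ = 0)
    (hgram : ⟪p 1, p 1⟫_ℂ * ⟪r 0, r 0⟫_ℂ ≠ ⟪p 0, p 0⟫_ℂ * ⟪r 1, r 1⟫_ℂ)
    (h21 : ⟪p 2, r 1⟫_ℂ ≠ 0) :
    IsIrreducibleOperator (ContinuousLinearMap.adjoint M) := by
  have hr' : r 0 ≠ 0 := by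
    intro h
    apply h21
    rw [← hr 0, h, map_zero, inner_zero_right]
  have hp' : p 0 ≠ 0 := by
    intro h
    apply h21
    rw [← hp 1, ← hp 0, h, map_zero, map_zero, inner_zero_left]
  refine ⟨⟨p 0, 0, hp'⟩, fun S hS h₁ h₂ => ?_⟩
  have : CompleteSpace S := hS.completeSpace_coe
  have comm := starProjection_apply_comm_of_reducing_adjoint M S h₁ h₂
  set P := S.starProjection with hPdef
  have hsym : ∀ f g, ⟪P f, g⟫_ℂ = ⟪f, P g⟫_ℂ := fun f g =>
    Submodule.inner_starProjection_left_eq_right S f g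
  -- Since `P` is self-adjoint and commutes with `M`, it preserves the orthogonal complement of the
  -- range of `M`.
  obtain ⟨A, B, hAB⟩ := eq_smul_add_smul_of_orthogonal_range hp hr hspan hp0 hr0 h00 hp' hr'
    (x := P (p 0)) (fun f => by rw [hsym, comm, hp0])
  obtain ⟨C, D, hCD⟩ := eq_smul_add_smul_of_orthogonal_range hp hr hspan hp0 hr0 h00 hp' hr'
    (x := P (r 0)) (fun f => by rw [hsym, comm, hr0])
  have hPp : ∀ n, P (p n) = A • p n + B • r n := by
    intro n
    induction n with
    | zero => exact hAB
    | succ n ih => rw [← hp, comm, ih, map_add, map_smul, map_smul, hp, hr]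
  have hPr : ∀ n, P (r n) = C • p n + D • r n := by
    intro n
    induction n with
    | zero => exact hCD
    | succ n ih => rw [← hr, comm, ih, map_add, map_smul, map_smul, hp, hr]
  -- Symmetry of `P` on `(p 0, r 0)` and `(p 1, r 1)` gives two linear relations between `conj B`
  -- and `C`; `hgram` says they are independent.
  have e0 : conj B * ⟪r 0, r 0⟫_ℂ = C * ⟪p 0, p 0⟫_ℂ := by
    have := hsym (p 0) (r 0)
    simp only [hPp, hPr, inner_add_left, inner_add_right, inner_smul_left, inner_smul_right,
      h00] at this
    linear_combination this
  have e1 : conj B * ⟪r 1, r 1⟫_ℂ = C * ⟪p 1, p 1⟫_ℂ := by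
    have := hsym (p 1) (r 1)
    simp only [hPp, hPr, inner_add_left, inner_add_right, inner_smul_left, inner_smul_right,
      h11] at this
    linear_combination this
  have hpp : ⟪p 0, p 0⟫_ℂ ≠ 0 := inner_self_ne_zero.2 hp'
  have hC : C = 0 := by
    have hrr : ⟪r 0, r 0⟫_ℂ ≠ 0 := inner_self_ne_zero.2 hr'
    by_contra hC
    apply hgram
    apply mul_left_cancel₀ hC
    linear_combination ⟪r 1, r 1⟫_ℂ * e0 - ⟪r 0, r 0⟫_ℂ * e1
  have hB : B = 0 := by
    have hrr : ⟪r 0, r 0⟫_ℂ ≠ 0 := inner_self_ne_zero.2 hr'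
    rw [hC, zero_mul] at e0
    exact (map_eq_zero (starRingEnd ℂ)).1 ((mul_eq_zero.1 e0).resolve_right hrr)
  have hA : conj A = A := by
    have := hsym (p 0) (p 0)
    rw [hPp, hB, zero_smul, add_zero, inner_smul_left, inner_smul_right] at this
    exact mul_right_cancel₀ hpp this
  -- The nonzero entry `⟪p 2, r 1⟫` couples the two chains, so their eigenvalues agree.
  have hAD : A = D := by
    have := hsym (p 2) (r 1)
    rw [hPp, hPr, hB, hC, zero_smul, zero_smul, add_zero, zero_add, inner_smul_left,
      inner_smul_right, hA] at this
    exact mul_right_cancel₀ h21 this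
  have hP : ∀ f, P f = A • f := by
    intro f
    refine sub_eq_zero.1 (hspan _ (fun n => ?_) fun n => ?_)
    · rw [inner_sub_right, ← hsym, hPp, hB, zero_smul, add_zero, inner_smul_left,
        inner_smul_right, hA, sub_self]
    · rw [inner_sub_right, ← hsym, hPr, hC, ← hAD, zero_smul, zero_add, inner_smul_left,
        inner_smul_right, hA, sub_self]
  by_cases hA0 : A = 0
  · left
    rw [Submodule.eq_bot_iff]
    intro x hx
    rw [← Submodule.starProjection_eq_self_iff.2 hx, ← hPdef, hP, hA0, zero_smul]
  · right
    rw [Submodule.eq_top_iff']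
    intro x
    have := S.starProjection_apply_mem x
    rw [← hPdef, hP] at this
    exact (S.smul_mem_iff hA0).1 this

end Reducing

/-! ### Reproducing kernel spaces from feature maps, and their uniqueness. -/

section Feature

variable {X V : Type*} [NormedAddCommGroup V] [InnerProductSpace ℂ V] [CompleteSpace V]
  {E : Type*} [NormedAddCommGroup E] [InnerProductSpace ℂ E] [CompleteSpace E]

/-- A total feature map turns its target into a reproducing kernel Hilbert space. -/
noncomputable abbrev RKHS.ofFeature (Γ : X → V →L[ℂ] E)
    (hΓ : ∀ c, (∀ x, ContinuousLinearMap.adjoint (Γ x) c = 0) → c = 0) : RKHS ℂ E X V where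
  coeCLM := .pi fun x => ContinuousLinearMap.adjoint (Γ x)
  coeCLM_injective := (injective_iff_map_eq_zero _).2 fun c hc => hΓ c fun x => congrFun hc x

lemma RKHS.kernel_ofFeature (Γ : X → V →L[ℂ] E)
    (hΓ : ∀ c, (∀ x, ContinuousLinearMap.adjoint (Γ x) c = 0) → c = 0) (x y : X) :
    let _ := RKHS.ofFeature Γ hΓ
    RKHS.kernel E x y = ContinuousLinearMap.adjoint (Γ x) ∘L Γ y := by
  intro _
  have h : ∀ x, RKHS.kerFun E x = Γ x := fun x => by
    have : ContinuousLinearMap.proj x ∘L RKHS.coeCLM ℂ (H := E) =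
      ContinuousLinearMap.adjoint (Γ x) := rfl
    rw [RKHS.kerFun, this, ContinuousLinearMap.adjoint_adjoint]
  rw [RKHS.kernel_apply, h, h]

lemma denseRange_linearCombination_of_total (Γ : X → V →L[ℂ] E)
    (hΓ : ∀ c, (∀ x, ContinuousLinearMap.adjoint (Γ x) c = 0) → c = 0) :
    DenseRange (Finsupp.linearCombination ℂ fun q : X × V => Γ q.1 q.2) := by
  have : (LinearMap.range (Finsupp.linearCombination ℂ fun q : X × V =>
      Γ q.1 q.2)).topologicalClosure = ⊤ := by
    rw [← Submodule.orthogonal_eq_bot_iff, Submodule.orthogonal_closure, Submodule.eq_bot_iff]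
    intro c hc
    refine hΓ c fun x => ext_inner_left ℂ fun v => ?_
    rw [ContinuousLinearMap.adjoint_inner_right, inner_zero_right]
    exact (Submodule.mem_orthogonal _ _).1 hc _ ⟨Finsupp.single (x, v) 1, by simp⟩
  rw [← Submodule.dense_iff_topologicalClosure_eq_top] at this
  exact this

/-- A reproducing kernel Hilbert space is determined by its kernel. -/
lemma RKHS.exists_linearIsometryEquiv_feature {H : Type*} [NormedAddCommGroup H]
    [InnerProductSpace ℂ H] [CompleteSpace H] [RKHS ℂ H X V] (Γ : X → V →L[ℂ] E)
    (hΓ : ∀ c, (∀ x, ContinuousLinearMap.adjoint (Γ x) c = 0) → c = 0)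
    (hK : ∀ x y, RKHS.kernel H x y = ContinuousLinearMap.adjoint (Γ x) ∘L Γ y) :
    ∃ U : H ≃ₗᵢ[ℂ] E, ∀ x v, U (RKHS.kerFun H x v) = Γ x v := by
  have hk : ∀ c : H, (∀ x, ContinuousLinearMap.adjoint (RKHS.kerFun H x) c = 0) → c = 0 := by
    intro c hc
    ext x
    rw [← RKHS.adjoint_kerFun, hc, RKHS.coe_zero, Pi.zero_apply]
  have h₁ := denseRange_linearCombination_of_total (RKHS.kerFun H) hk
  have h₂ := denseRange_linearCombination_of_total Γ hΓ
  -- Kernel functions and feature vectors have the same Gram matrix, so matching them is isometric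
  -- on finite combinations and extends by density.
  have hinner : ∀ x y u v, ⟪RKHS.kerFun H x u, RKHS.kerFun H y v⟫_ℂ = ⟪Γ x u, Γ y v⟫_ℂ := by
    intro x y u v
    rw [RKHS.kerFun_inner, RKHS.kerFun_apply, hK, ContinuousLinearMap.comp_apply,
      ContinuousLinearMap.adjoint_inner_right]
  have hnorm : ∀ s : X × V →₀ ℂ,
      ‖Finsupp.linearCombination ℂ (fun q : X × V => Γ q.1 q.2) (LinearEquiv.refl ℂ _ s)‖ =
      ‖Finsupp.linearCombination ℂ (fun q : X × V => RKHS.kerFun H q.1 q.2) s‖ := by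
    intro s
    have : ⟪Finsupp.linearCombination ℂ (fun q : X × V => Γ q.1 q.2) s,
        Finsupp.linearCombination ℂ (fun q : X × V => Γ q.1 q.2) s⟫_ℂ =
      ⟪Finsupp.linearCombination ℂ (fun q : X × V => RKHS.kerFun H q.1 q.2) s,
        Finsupp.linearCombination ℂ (fun q : X × V => RKHS.kerFun H q.1 q.2) s⟫_ℂ := by
      simp only [Finsupp.linearCombination_apply, Finsupp.sum_inner, Finsupp.inner_sum,
        inner_smul_left, inner_smul_right, hinner]
    rw [LinearEquiv.refl_apply, ← sq_eq_sq₀ (norm_nonneg _) (norm_nonneg _)]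
    rw [inner_self_eq_norm_sq_to_K, inner_self_eq_norm_sq_to_K] at this
    exact_mod_cast this
  refine ⟨LinearEquiv.extendOfIsometry (LinearEquiv.refl ℂ _) _ _ h₁ h₂ hnorm, fun x v => ?_⟩
  have := LinearEquiv.extendOfIsometry_eq (LinearEquiv.refl ℂ _) _ _ h₁ h₂ hnorm
    (Finsupp.single (x, v) 1)
  simpa using this

end Feature

/-! ### Weighted shifts on `ℓ²`. -/

section WeightedComposition

/-- The operator `x ↦ (n ↦ w n * x (σ n))` on `ℓ²`, for bounded weights `w` and injective `σ`. -/
lemma exists_weighted_comp_l2 (w : ℕ → ℂ) (C : ℝ) (hw : ∀ n, ‖w n‖ ≤ C) (σ : ℕ → ℕ)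
    (hσ : Function.Injective σ) :
    ∃ T : lp (fun _ : ℕ => ℂ) 2 →L[ℂ] lp (fun _ : ℕ => ℂ) 2, ∀ x n, T x n = w n * x (σ n) := by
  have h2 : (0 : ℝ) < (2 : ℝ≥0∞).toReal := by norm_num
  have hC : 0 ≤ C := (norm_nonneg _).trans (hw 0)
  have hle : ∀ (x : lp (fun _ : ℕ => ℂ) 2) n,
      ‖w n * x (σ n)‖ ^ (2 : ℝ≥0∞).toReal ≤
        C ^ (2 : ℝ≥0∞).toReal * ‖x (σ n)‖ ^ (2 : ℝ≥0∞).toReal := by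
    intro x n
    rw [norm_mul, Real.mul_rpow (norm_nonneg _) (norm_nonneg _)]
    gcongr
    exact hw n
  have hsum : ∀ x : lp (fun _ : ℕ => ℂ) 2, Summable fun n => ‖x (σ n)‖ ^ (2 : ℝ≥0∞).toReal :=
    fun x => ((lp.memℓp x).summable h2).comp_injective hσ
  have hmem : ∀ x : lp (fun _ : ℕ => ℂ) 2, Memℓp (fun n => w n * x (σ n)) 2 := fun x =>
    memℓp_gen (Summable.of_nonneg_of_le (fun n => by positivity) (hle x) ((hsum x).mul_left _))
  let L : lp (fun _ : ℕ => ℂ) 2 →ₗ[ℂ] lp (fun _ : ℕ => ℂ) 2 :=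
    { toFun := fun x => ⟨fun n => w n * x (σ n), hmem x⟩
      map_add' := fun x y => by ext n; exact mul_add _ _ _
      map_smul' := fun a x => by ext n; exact mul_left_comm _ _ _ }
  refine ⟨L.mkContinuous C fun x => ?_, fun x n => rfl⟩
  refine lp.norm_le_of_tsum_le h2 (by positivity) ?_
  rw [Real.mul_rpow hC (norm_nonneg _), lp.norm_rpow_eq_tsum h2, ← tsum_mul_left]
  refine ((Summable.of_nonneg_of_le (fun n => by positivity) (hle x)
    ((hsum x).mul_left _)).tsum_le_tsum (hle x) ((hsum x).mul_left _)).trans ?_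
  rw [tsum_mul_left, tsum_mul_left]
  refine mul_le_mul_of_nonneg_left ?_ (by positivity)
  exact tsum_comp_le_tsum_of_inj ((lp.memℓp x).summable h2) (fun n => by positivity) hσ

end WeightedComposition

/-! ### Binomial series for `(1 - x)^(-p)`. -/

section BinomialCoefficients

/-- The Taylor coefficient of `x ^ n` in `(1 - x) ^ (-p)`. -/
noncomputable def negBinomCoeff (p : ℝ) (n : ℕ) : ℝ := ∏ i ∈ Finset.range n, (p + i) / (i + 1)

@[simp]
lemma negBinomCoeff_zero (p : ℝ) : negBinomCoeff p 0 = 1 := by simp [negBinomCoeff]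

lemma negBinomCoeff_succ (p : ℝ) (n : ℕ) :
    negBinomCoeff p (n + 1) = negBinomCoeff p n * ((p + n) / (n + 1)) :=
  Finset.prod_range_succ _ _

lemma negBinomCoeff_pos {p : ℝ} (hp : 0 < p) (n : ℕ) : 0 < negBinomCoeff p n :=
  Finset.prod_pos fun i _ => by positivity

lemma negBinomCoeff_mul_add (p : ℝ) (n : ℕ) :
    negBinomCoeff p n * (p + n) = p * negBinomCoeff (p + 1) n := by
  induction n with
  | zero => simp
  | succ n ih =>
    rw [negBinomCoeff_succ, negBinomCoeff_succ]
    have : (n : ℝ) + 1 ≠ 0 := by positivity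
    push_cast
    field_simp
    linear_combination (p + n + 1) * ih

lemma succ_mul_negBinomCoeff_succ (p : ℝ) (n : ℕ) :
    (n + 1) * negBinomCoeff p (n + 1) = p * negBinomCoeff (p + 1) n := by
  rw [← negBinomCoeff_mul_add, negBinomCoeff_succ]
  have : (n : ℝ) + 1 ≠ 0 := by positivity
  field_simp

/-- This bounds the weights of the backward shift, also for `p < 1`, where the coefficients
decrease. -/
lemma negBinomCoeff_le_mul_succ {p : ℝ} (hp : 0 < p) (n : ℕ) :
    negBinomCoeff p n ≤ (1 + 1 / p) * negBinomCoeff p (n + 1) := by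
  rw [negBinomCoeff_succ]
  have h : 1 ≤ (1 + 1 / p) * ((p + n) / (n + 1)) := by
    have : (1 + 1 / p) * ((p + n) / (n + 1)) = (p + n + 1 + n / p) / (n + 1) := by
      field_simp
      ring
    rw [this, le_div_iff₀ (by positivity)]
    have : 0 ≤ (n : ℝ) / p := by positivity
    linarith
  nlinarith [negBinomCoeff_pos hp n]

lemma negBinomCoeff_le_add_one {p : ℝ} (hp : 0 < p) (n : ℕ) :
    negBinomCoeff p n ≤ negBinomCoeff (p + 1) n := by
  have h := negBinomCoeff_mul_add p n
  have h1 := negBinomCoeff_pos hp n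
  have : p * negBinomCoeff p n ≤ p * negBinomCoeff (p + 1) n := by
    rw [← h]
    nlinarith [(Nat.cast_nonneg n : (0 : ℝ) ≤ n)]
  exact le_of_mul_le_mul_left this hp

lemma ringChoose_eq_negBinomCoeff (p : ℝ) (n : ℕ) :
    Ring.choose ((p : ℂ) + n - 1) n = (negBinomCoeff p n : ℂ) := by
  have h1 : Ring.choose ((p : ℂ) + n - 1) n = Ring.multichoose (p : ℂ) n := by
    rw [Ring.choose]
    congr 1
    ring
  have h2 := Ring.factorial_nsmul_multichoose_eq_ascPochhammer (p : ℂ) n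
  rw [Polynomial.ascPochhammer_smeval_eq_eval, nsmul_eq_mul] at h2
  have h3 : (n.factorial : ℂ) * (negBinomCoeff p n : ℂ) = (ascPochhammer ℂ n).eval (p : ℂ) := by
    clear h1 h2
    induction n with
    | zero => simp
    | succ n ih =>
      rw [ascPochhammer_succ_eval, ← ih, negBinomCoeff_succ, Nat.factorial_succ]
      have : (n : ℂ) + 1 ≠ 0 := by exact_mod_cast n.succ_ne_zero
      push_cast
      field_simp
  rw [h1]
  exact mul_left_cancel₀ (by exact_mod_cast n.factorial_ne_zero) (h2.trans h3.symm)

lemma hasSum_negBinomCoeff (p : ℝ) {x : ℂ} (hx : ‖x‖ < 1) :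
    HasSum (fun n => (negBinomCoeff p n : ℂ) * x ^ n) ((1 - x) ^ (-(p : ℂ))) := by
  have h := (Complex.one_div_one_sub_cpow_hasFPowerSeriesOnBall_zero (p : ℂ)).hasSum
    (y := x) (by
      rw [← ENNReal.ofReal_one, Metric.eball_ofReal]
      simpa using hx)
  simpa [ringChoose_eq_negBinomCoeff, Complex.cpow_neg, FormalMultilinearSeries.ofScalars_apply_eq,
    mul_comm] using h

lemma hasSum_mul_negBinomCoeff (p : ℝ) {x : ℂ} (hx : ‖x‖ < 1) :
    HasSum (fun n : ℕ => (n : ℂ) * negBinomCoeff p n * x ^ (n - 1))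
      (p * (1 - x) ^ (-((p + 1 : ℝ) : ℂ))) := by
  -- The term `n = 0` carries the factor `n`, so the truncated exponent `n - 1` is harmless there.
  rw [← hasSum_nat_add_iff' 1]
  have h := (hasSum_negBinomCoeff (p + 1) hx).mul_left (p : ℂ)
  convert! h using 1
  · funext n
    have := congrArg (fun r : ℝ => (r : ℂ)) (succ_mul_negBinomCoeff_succ p n)
    push_cast at this ⊢
    rw [this, mul_assoc]
  · simp

lemma one_sub_ne_zero_of_norm_lt_one {x : ℂ} (hx : ‖x‖ < 1) : 1 - x ≠ 0 := by
  intro h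
  rw [← sub_eq_zero.1 h] at hx
  simp at hx

lemma one_sub_cpow_neg (p : ℝ) {x : ℂ} (hx : ‖x‖ < 1) :
    (1 - x) ^ (-(p : ℂ)) = (1 - x) * (1 - x) ^ (-((p + 1 : ℝ) : ℂ)) := by
  have h : -(p : ℂ) = 1 + -((p + 1 : ℝ) : ℂ) := by push_cast; ring
  rw [h, Complex.cpow_add _ _ (one_sub_ne_zero_of_norm_lt_one hx), Complex.cpow_one]

/-- With `x = z w̄`, the sum is the mixed derivative `∂_z ∂̄_w` of `(1 - z w̄)^(-p)`. -/
lemma hasSum_sq_mul_negBinomCoeff (p : ℝ) {x : ℂ} (hx : ‖x‖ < 1) :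
    HasSum (fun n : ℕ => (n : ℂ) ^ 2 * negBinomCoeff p n * x ^ (n - 1))
      (p * (1 + p * x) * (1 - x) ^ (-((p + 2 : ℝ) : ℂ))) := by
  rw [← hasSum_nat_add_iff' 1]
  have h1 := hasSum_negBinomCoeff (p + 1) hx
  have h2 := (hasSum_mul_negBinomCoeff (p + 1) hx).mul_left x
  convert! (h1.add h2).mul_left (p : ℂ) using 1
  · funext n
    have := congrArg (fun r : ℝ => (r : ℂ)) (succ_mul_negBinomCoeff_succ p n)
    have hx' : (n : ℂ) * x ^ n = n * (x * x ^ (n - 1)) := by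
      rcases n with _ | n
      · simp
      · rw [Nat.add_sub_cancel, pow_succ']
    push_cast at this ⊢
    linear_combination ((n : ℂ) + 1) * x ^ n * this + p * negBinomCoeff (p + 1) n * hx'
  · rw [one_sub_cpow_neg (p + 1) hx, show p + 1 + 1 = p + 2 by ring]
    push_cast
    simp
    ring

lemma eq_zero_of_forall_hasSum_pow_zero {c : ℕ → ℂ}
    (h : ∀ x : ℂ, ‖x‖ < 1 → HasSum (fun n => c n * x ^ n) 0) (n : ℕ) : c n = 0 := by
  have h1 : HasFPowerSeriesOnBall (fun _ : ℂ => (0 : ℂ))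
      (FormalMultilinearSeries.ofScalars ℂ c) 0 1 := by
    refine ⟨?_, by norm_num, ?_⟩
    · refine ENNReal.le_of_forall_nnreal_lt fun r hr => ?_
      refine FormalMultilinearSeries.le_radius_of_summable _ ?_
      have := (h (r : ℂ) (by simpa using hr)).summable.norm
      simpa using this
    · intro y hy
      rw [← ENNReal.ofReal_one, Metric.eball_ofReal] at hy
      simpa [FormalMultilinearSeries.ofScalars_apply_eq, mul_comm] using h y (by simpa using hy)
  have h2 := h1.hasFPowerSeriesAt.eq_zero
  exact (FormalMultilinearSeries.ofScalars_eq_zero (E := ℂ) (c := c) n).1 (by rw [h2]; rfl)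

end BinomialCoefficients

/-! ### Membership in `ℓ²`. -/

section L2

lemma memℓp_two_of_summable_mul_conj {f : ℕ → ℂ} (h : Summable fun n => f n * conj (f n)) :
    Memℓp f 2 := by
  refine memℓp_gen (h.norm.congr fun n => ?_)
  rw [norm_mul, RCLike.norm_conj, ← sq]
  norm_num

end L2

/-! ### Closed form of the jet kernel on the diagonal. -/

section JetKernel

lemma conj_one_sub_cpow (s : ℝ) {x : ℂ} (hx : ‖x‖ < 1) :
    conj ((1 - x) ^ (s : ℂ)) = (1 - conj x) ^ (s : ℂ) := by
  have harg : (1 - x).arg ≠ Real.pi := by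
    rw [sub_eq_add_neg]
    exact Complex.slitPlane_arg_ne_pi (Complex.mem_slitPlane_of_norm_lt_one (by simpa using hx))
  have := Complex.conj_cpow (1 - x) (s : ℂ) harg
  rw [Complex.conj_ofReal] at this
  rw [← this, map_sub, map_one]

lemma hasDerivAt_one_sub_mul_cpow (b : ℝ) (a z : ℂ) (h : ‖z * a‖ < 1) :
    HasDerivAt (fun z => (1 - z * a) ^ (-(b : ℂ)))
      (b * a * (1 - z * a) ^ (-((b + 1 : ℝ) : ℂ))) z := by
  have h0 : 1 - z * a ∈ Complex.slitPlane := by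
    rw [sub_eq_add_neg]
    exact Complex.mem_slitPlane_of_norm_lt_one (by simpa using h)
  have h1 : HasDerivAt (fun z => 1 - z * a) (-a) z := by
    simpa using ((hasDerivAt_id z).mul_const a).const_sub 1
  convert h1.cpow_const (c := -(b : ℂ)) h0 using 1
  rw [show -((b + 1 : ℝ) : ℂ) = -(b : ℂ) - 1 by push_cast; ring]
  ring

lemma norm_mul_conj_lt_one {z w : ℂ} (hz : ‖z‖ < 1) (hw : ‖w‖ < 1) : ‖z * conj w‖ < 1 := by
  rw [norm_mul, RCLike.norm_conj]
  exact mul_lt_one_of_nonneg_of_lt_one_left (norm_nonneg _) hz hw.le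

variable (α β : ℝ) {z w : ℂ}

/-- Conjugation makes the inner function holomorphic in `w₂`. The power identity is used only for
`|w₂| < 1`, so functions are compared as germs at `w`, which is enough for derivatives. -/
lemma jetMatrix_bidiscKernel_zero_apply (j : Fin 2) (hz : ‖z‖ < 1) (hw : ‖w‖ < 1) :
    jetMatrix 2 (bidiscKernel α β) (z, z) (w, w) 0 j =
      conj (iteratedDeriv j (fun w₂ => conj ((1 - z * conj w) ^ (-(α : ℂ))) *
        (1 - w₂ * conj z) ^ (-(β : ℂ))) w) := by
  have : (fun w₂ => conj (iteratedDeriv 0 (fun z₂ => bidiscKernel α β (z, z₂) (w, w₂)) z))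
      =ᶠ[nhds w] fun w₂ => conj ((1 - z * conj w) ^ (-(α : ℂ))) *
        (1 - w₂ * conj z) ^ (-(β : ℂ)) := by
    filter_upwards [(isOpen_lt continuous_norm continuous_const).mem_nhds hw] with w₂ hw₂
    have := conj_one_sub_cpow (-β) (norm_mul_conj_lt_one hz hw₂)
    push_cast at this
    simp only [iteratedDeriv_zero, bidiscKernel, map_mul, this, Complex.conj_conj]
    rw [mul_comm w₂]
  exact congrArg conj (this.iteratedDeriv_eq j)

lemma jetMatrix_bidiscKernel_one_apply (j : Fin 2) (hz : ‖z‖ < 1) (hw : ‖w‖ < 1) :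
    jetMatrix 2 (bidiscKernel α β) (z, z) (w, w) 1 j =
      conj (iteratedDeriv j (fun w₂ => conj ((1 - z * conj w) ^ (-(α : ℂ))) *
        (β * w₂ * (1 - w₂ * conj z) ^ (-((β + 1 : ℝ) : ℂ)))) w) := by
  have : (fun w₂ => conj (iteratedDeriv 1 (fun z₂ => bidiscKernel α β (z, z₂) (w, w₂)) z))
      =ᶠ[nhds w] fun w₂ => conj ((1 - z * conj w) ^ (-(α : ℂ))) *
        (β * w₂ * (1 - w₂ * conj z) ^ (-((β + 1 : ℝ) : ℂ))) := by
    filter_upwards [(isOpen_lt continuous_norm continuous_const).mem_nhds hw] with w₂ hw₂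
    have h := norm_mul_conj_lt_one hz hw₂
    have := conj_one_sub_cpow (-(β + 1)) h
    rw [Complex.ofReal_neg] at this
    have hd := (hasDerivAt_one_sub_mul_cpow β (conj w₂) z h).const_mul
      ((1 - z * conj w) ^ (-(α : ℂ)))
    simp only [iteratedDeriv_one, bidiscKernel]
    rw [hd.deriv]
    simp only [map_mul, this, Complex.conj_conj, Complex.conj_ofReal]
    rw [mul_comm w₂ (conj z)]
  exact congrArg conj (this.iteratedDeriv_eq j)

lemma jetMatrix_bidiscKernel (hz : ‖z‖ < 1) (hw : ‖w‖ < 1) :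
    jetMatrix 2 (bidiscKernel α β) (z, z) (w, w) =
      !![(1 - z * conj w) ^ (-((α + β : ℝ) : ℂ)),
          β * z * (1 - z * conj w) ^ (-((α + β + 1 : ℝ) : ℂ));
        β * conj w * (1 - z * conj w) ^ (-((α + β + 1 : ℝ) : ℂ)),
          β * (1 + β * (z * conj w)) * (1 - z * conj w) ^ (-((α + β + 2 : ℝ) : ℂ))] := by
  have hwz := norm_mul_conj_lt_one hw hz
  have hzw := norm_mul_conj_lt_one hz hw
  have hne := one_sub_ne_zero_of_norm_lt_one hzw
  have hc : ∀ s : ℝ, conj ((1 - w * conj z) ^ (-(s : ℂ))) = (1 - z * conj w) ^ (-(s : ℂ)) := by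
    intro s
    have := conj_one_sub_cpow (-s) hwz
    rw [Complex.ofReal_neg] at this
    rw [this, map_mul, Complex.conj_conj, mul_comm z]
  have hadd : ∀ s : ℝ, (1 - z * conj w) ^ (-((α + s : ℝ) : ℂ)) =
      (1 - z * conj w) ^ (-(α : ℂ)) * (1 - z * conj w) ^ (-(s : ℂ)) := by
    intro s
    rw [← Complex.cpow_add _ _ hne]
    congr 1
    push_cast
    ring
  ext i j
  fin_cases i
  · refine (jetMatrix_bidiscKernel_zero_apply α β j hz hw).trans ?_
    fin_cases j
    · simp [hc, hadd, -Complex.ofReal_add]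
    · have := (hasDerivAt_one_sub_mul_cpow β (conj z) w hwz).const_mul
        (conj ((1 - z * conj w) ^ (-(α : ℂ))))
      simp only [Fin.mk_one, iteratedDeriv_one, this.deriv]
      simp only [map_mul, Complex.conj_conj, hc, Complex.conj_ofReal, add_assoc α β, hadd]
      simp
      ring
  · refine (jetMatrix_bidiscKernel_one_apply α β j hz hw).trans ?_
    fin_cases j
    · simp only [Fin.zero_eta, iteratedDeriv_zero]
      simp only [map_mul, Complex.conj_conj, hc, Complex.conj_ofReal, add_assoc α β, hadd]
      simp
      ring
    · have := ((((hasDerivAt_id w).const_mul (β : ℂ)).mul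
        (hasDerivAt_one_sub_mul_cpow (β + 1) (conj z) w hwz))).const_mul
        (conj ((1 - z * conj w) ^ (-(α : ℂ))))
      simp only [Fin.mk_one, iteratedDeriv_one]
      refine (congrArg conj this.deriv).trans ?_
      simp only [map_mul, map_add, id_eq, Complex.conj_conj, hc, Complex.conj_ofReal,
        add_assoc α β, hadd, one_sub_cpow_neg (β + 1) hzw, map_one,
        show β + 1 + 1 = β + 2 by ring]
      simp
      ring

end JetKernel

/-! ### The model on `ℓ² ⊕ ℓ²`. -/

section Model

open Complex (UnitDisc)

variable {p : ℝ} (hp : 0 < p)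

lemma sqrt_negBinomCoeff_mul_self (hp : 0 < p) (n : ℕ) :
    ((√(negBinomCoeff p n) : ℝ) : ℂ) * (√(negBinomCoeff p n) : ℝ) = negBinomCoeff p n := by
  exact_mod_cast Real.mul_self_sqrt (negBinomCoeff_pos hp n).le

lemma sqrt_negBinomCoeff_pos (hp : 0 < p) (n : ℕ) : 0 < √(negBinomCoeff p n) :=
  Real.sqrt_pos.2 (negBinomCoeff_pos hp n)

lemma sqrt_negBinomCoeff_ne_zero (hp : 0 < p) (n : ℕ) :
    ((√(negBinomCoeff p n) : ℝ) : ℂ) ≠ 0 :=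
  Complex.ofReal_ne_zero.2 (sqrt_negBinomCoeff_pos hp n).ne'

/-- The sequence `√aₙ z̄ⁿ`, where `∑ aₙ xⁿ = (1 - x) ^ (-p)`. -/
noncomputable def powSeq (z : UnitDisc) : lp (fun _ : ℕ => ℂ) 2 :=
  ⟨fun n => (√(negBinomCoeff p n) : ℝ) * conj (z : ℂ) ^ n, by
    apply memℓp_two_of_summable_mul_conj
    refine (hasSum_negBinomCoeff p (norm_mul_conj_lt_one z.norm_lt_one z.norm_lt_one)).summable.congr
      fun n => ?_
    rw [← sqrt_negBinomCoeff_mul_self hp, map_mul, Complex.conj_ofReal, map_pow, Complex.conj_conj]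
    ring⟩

/-- The sequence `n √aₙ z̄ⁿ⁻¹`, where `∑ aₙ xⁿ = (1 - x) ^ (-p)`. -/
noncomputable def powDerivSeq (z : UnitDisc) : lp (fun _ : ℕ => ℂ) 2 :=
  ⟨fun n => n * (√(negBinomCoeff p n) : ℝ) * conj (z : ℂ) ^ (n - 1), by
    apply memℓp_two_of_summable_mul_conj
    refine (hasSum_sq_mul_negBinomCoeff p
      (norm_mul_conj_lt_one z.norm_lt_one z.norm_lt_one)).summable.congr fun n => ?_
    rw [← sqrt_negBinomCoeff_mul_self hp, map_mul, map_mul, Complex.conj_ofReal, map_pow,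
      Complex.conj_conj, Complex.conj_natCast]
    ring⟩

lemma powSeq_apply (z : UnitDisc) (n : ℕ) :
    powSeq hp z n = (√(negBinomCoeff p n) : ℝ) * conj (z : ℂ) ^ n := rfl

lemma powDerivSeq_apply (z : UnitDisc) (n : ℕ) :
    powDerivSeq hp z n = n * (√(negBinomCoeff p n) : ℝ) * conj (z : ℂ) ^ (n - 1) := rfl

lemma inner_powSeq_powSeq (z w : UnitDisc) :
    ⟪powSeq hp z, powSeq hp w⟫_ℂ = (1 - (z : ℂ) * conj (w : ℂ)) ^ (-(p : ℂ)) := by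
  refine (lp.hasSum_inner (𝕜 := ℂ) _ _).unique ?_
  convert! hasSum_negBinomCoeff p (norm_mul_conj_lt_one z.norm_lt_one w.norm_lt_one) using 1
  funext n
  rw [powSeq_apply, powSeq_apply, RCLike.inner_apply', ← sqrt_negBinomCoeff_mul_self hp, map_mul,
    Complex.conj_ofReal, map_pow, Complex.conj_conj]
  ring

lemma inner_powSeq_powDerivSeq (z w : UnitDisc) :
    ⟪powSeq hp z, powDerivSeq hp w⟫_ℂ =
      p * z * (1 - (z : ℂ) * conj (w : ℂ)) ^ (-((p + 1 : ℝ) : ℂ)) := by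
  refine (lp.hasSum_inner (𝕜 := ℂ) _ _).unique ?_
  convert! (hasSum_mul_negBinomCoeff p
    (norm_mul_conj_lt_one z.norm_lt_one w.norm_lt_one)).mul_left (z : ℂ) using 1
  · funext n
    rw [powSeq_apply, powDerivSeq_apply, RCLike.inner_apply', ← sqrt_negBinomCoeff_mul_self hp,
      map_mul, Complex.conj_ofReal, map_pow, Complex.conj_conj]
    rcases n with _ | n
    · simp
    · rw [Nat.add_sub_cancel]
      ring
  · ring

lemma inner_powDerivSeq_powSeq (z w : UnitDisc) :
    ⟪powDerivSeq hp z, powSeq hp w⟫_ℂ =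
      p * conj (w : ℂ) * (1 - (z : ℂ) * conj (w : ℂ)) ^ (-((p + 1 : ℝ) : ℂ)) := by
  refine (lp.hasSum_inner (𝕜 := ℂ) _ _).unique ?_
  convert! (hasSum_mul_negBinomCoeff p
    (norm_mul_conj_lt_one z.norm_lt_one w.norm_lt_one)).mul_left (conj (w : ℂ)) using 1
  · funext n
    rw [powSeq_apply, powDerivSeq_apply, RCLike.inner_apply', ← sqrt_negBinomCoeff_mul_self hp,
      map_mul, map_mul, Complex.conj_ofReal, map_pow, Complex.conj_conj, Complex.conj_natCast]
    rcases n with _ | n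
    · simp
    · rw [Nat.add_sub_cancel]
      ring
  · ring

lemma inner_powDerivSeq_powDerivSeq (z w : UnitDisc) :
    ⟪powDerivSeq hp z, powDerivSeq hp w⟫_ℂ =
      p * (1 + p * ((z : ℂ) * conj (w : ℂ))) *
        (1 - (z : ℂ) * conj (w : ℂ)) ^ (-((p + 2 : ℝ) : ℂ)) := by
  refine (lp.hasSum_inner (𝕜 := ℂ) _ _).unique ?_
  convert! hasSum_sq_mul_negBinomCoeff p (norm_mul_conj_lt_one z.norm_lt_one w.norm_lt_one)
    using 1
  funext n
  rw [powDerivSeq_apply, powDerivSeq_apply, RCLike.inner_apply', ← sqrt_negBinomCoeff_mul_self hp,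
    map_mul, map_mul, Complex.conj_ofReal, map_pow, Complex.conj_conj, Complex.conj_natCast]
  ring

lemma eq_zero_of_forall_inner_powSeq {x : lp (fun _ : ℕ => ℂ) 2}
    (h : ∀ z, ⟪powSeq hp z, x⟫_ℂ = 0) : x = 0 := by
  have h1 : ∀ z : ℂ, ‖z‖ < 1 →
      HasSum (fun n => ((√(negBinomCoeff p n) : ℝ) : ℂ) * x n * z ^ n) 0 := by
    intro z hz
    have := lp.hasSum_inner (𝕜 := ℂ) (powSeq hp (UnitDisc.mk z hz)) x
    rw [h] at this
    convert! this using 1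
    funext n
    rw [powSeq_apply, RCLike.inner_apply', map_mul, Complex.conj_ofReal, map_pow,
      Complex.conj_conj, UnitDisc.coe_mk]
    ring
  ext n
  exact (mul_eq_zero.1 (eq_zero_of_forall_hasSum_pow_zero h1 n)).resolve_left
    (sqrt_negBinomCoeff_ne_zero hp n)

/-- The weights `√(aₙ / aₙ₊₁)` make `powSeq` an eigenvector for `z̄`; the second relation is the
derivative of the first in `z̄`. -/
lemma exists_backward_shift_powSeq :
    ∃ T : lp (fun _ : ℕ => ℂ) 2 →L[ℂ] lp (fun _ : ℕ => ℂ) 2,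
      (∀ z : UnitDisc, T (powSeq hp z) = conj (z : ℂ) • powSeq hp z) ∧
      ∀ z : UnitDisc,
        T (powDerivSeq hp z) = conj (z : ℂ) • powDerivSeq hp z + powSeq hp z := by
  obtain ⟨T, hT⟩ := exists_weighted_comp_l2
    (fun n => ((√(negBinomCoeff p n) / √(negBinomCoeff p (n + 1)) : ℝ) : ℂ)) (√(1 + 1 / p))
    (fun n => by
      rw [Complex.norm_of_nonneg (by positivity), div_le_iff₀ (sqrt_negBinomCoeff_pos hp _),
        ← Real.sqrt_mul (by positivity)]
      exact Real.sqrt_le_sqrt (negBinomCoeff_le_mul_succ hp n)) Nat.succ Nat.succ_injective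
  refine ⟨T, fun z => ?_, fun z => ?_⟩
  · ext n
    have := sqrt_negBinomCoeff_ne_zero hp (n + 1)
    rw [hT, lp.coeFn_smul, Pi.smul_apply, powSeq_apply, powSeq_apply, smul_eq_mul,
      pow_succ]
    push_cast
    field_simp
  · ext n
    have := sqrt_negBinomCoeff_ne_zero hp (n + 1)
    rw [hT, lp.coeFn_add, Pi.add_apply, lp.coeFn_smul, Pi.smul_apply, powSeq_apply,
      powDerivSeq_apply, powDerivSeq_apply, smul_eq_mul, Nat.succ_eq_add_one, Nat.add_sub_cancel]
    push_cast
    field_simp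
    rcases n with _ | n
    · simp
    · rw [Nat.add_sub_cancel]
      ring

/-- The adjoint of this map is the inclusion of the space with kernel `(1 - z w̄)^(-p)` into the one
with exponent `-p - 2`. -/
lemma exists_map_powSeq_add_two :
    ∃ T : lp (fun _ : ℕ => ℂ) 2 →L[ℂ] lp (fun _ : ℕ => ℂ) 2,
      ∀ z : UnitDisc, T (powSeq (add_pos hp two_pos) z) = powSeq hp z := by
  have hp2 : 0 < p + 2 := add_pos hp two_pos
  obtain ⟨T, hT⟩ := exists_weighted_comp_l2
    (fun n => ((√(negBinomCoeff p n) / √(negBinomCoeff (p + 2) n) : ℝ) : ℂ)) 1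
    (fun n => by
      rw [Complex.norm_of_nonneg (by positivity), div_le_one (sqrt_negBinomCoeff_pos hp2 _)]
      refine Real.sqrt_le_sqrt ((negBinomCoeff_le_add_one hp n).trans ?_)
      have := negBinomCoeff_le_add_one (p := p + 1) (by positivity) n
      rwa [show p + 1 + 1 = p + 2 by ring] at this) id Function.injective_id
  refine ⟨T, fun z => ?_⟩
  ext n
  have := sqrt_negBinomCoeff_ne_zero hp2 n
  rw [hT, id, powSeq_apply, powSeq_apply]
  push_cast
  field_simp

/-- The Hilbert space `ℓ² ⊕ ℓ²`. -/
abbrev L2Pair : Type := WithLp 2 (lp (fun _ : ℕ => ℂ) 2 × lp (fun _ : ℕ => ℂ) 2)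

lemma L2Pair.inner_def (x y : L2Pair) : ⟪x, y⟫_ℂ = ⟪x.fst, y.fst⟫_ℂ + ⟪x.snd, y.snd⟫_ℂ :=
  WithLp.prod_inner_apply x y

variable (t s : ℝ)

/-- The feature map of the kernel `(D ⊗ D̄) (1 - z w̄) ^ (-p) + s² (1 - z w̄) ^ (-p - 2) E₁₁`, where
`D = (1, t ∂)`. -/
noncomputable def jetFeature (z : UnitDisc) : EuclideanSpace ℂ (Fin 2) →L[ℂ] L2Pair :=
  (EuclideanSpace.proj 0 : EuclideanSpace ℂ (Fin 2) →L[ℂ] ℂ).smulRight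
      (WithLp.toLp 2 (powSeq hp z, 0)) +
    (EuclideanSpace.proj 1 : EuclideanSpace ℂ (Fin 2) →L[ℂ] ℂ).smulRight
      (WithLp.toLp 2 ((t : ℂ) • powDerivSeq hp z, (s : ℂ) • powSeq (add_pos hp two_pos) z))

lemma jetFeature_apply (z : UnitDisc) (v : EuclideanSpace ℂ (Fin 2)) :
    jetFeature hp t s z v = WithLp.toLp 2 (v 0 • powSeq hp z + v 1 • (t : ℂ) • powDerivSeq hp z,
      v 1 • (s : ℂ) • powSeq (add_pos hp two_pos) z) := by
  apply (WithLp.equiv 2 _).injective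
  ext1
  · simp [jetFeature]
  · simp [jetFeature]

lemma inner_jetFeature (z : UnitDisc) (v : EuclideanSpace ℂ (Fin 2)) (x : L2Pair) :
    ⟪jetFeature hp t s z v, x⟫_ℂ = conj (v 0) * ⟪powSeq hp z, x.fst⟫_ℂ +
      conj (v 1) * (t * ⟪powDerivSeq hp z, x.fst⟫_ℂ +
        s * ⟪powSeq (add_pos hp two_pos) z, x.snd⟫_ℂ) := by
  rw [jetFeature_apply, L2Pair.inner_def]
  simp only [WithLp.toLp_fst, WithLp.toLp_snd, inner_add_left, inner_smul_left,
    Complex.conj_ofReal]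
  ring

lemma eq_zero_of_forall_inner_jetFeature (hs : s ≠ 0) {x : L2Pair}
    (h : ∀ z v, ⟪jetFeature hp t s z v, x⟫_ℂ = 0) : x = 0 := by
  have h1 : x.fst = 0 := eq_zero_of_forall_inner_powSeq hp fun z => by
    have := h z (EuclideanSpace.single 0 1)
    rw [inner_jetFeature] at this
    simpa using this
  have h2 : x.snd = 0 := eq_zero_of_forall_inner_powSeq (add_pos hp two_pos) fun z => by
    have := h z (EuclideanSpace.single 1 1)
    rw [inner_jetFeature, h1] at this
    simpa [hs] using this
  apply (WithLp.equiv 2 _).injective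
  ext1
  · exact h1
  · exact h2

/-- `N` is the adjoint of multiplication by `z`. As `z f' = (z f)' - f`, multiplication sends `(f,
g)` to `(z f, z g - (t/s) f)`; the adjoint of the last term is the correction `-(t/s) D`. -/
lemma exists_clm_jetFeature_eigenvector (hs : s ≠ 0) :
    ∃ N : L2Pair →L[ℂ] L2Pair,
      ∀ z v, N (jetFeature hp t s z v) = conj (z : ℂ) • jetFeature hp t s z v := by
  obtain ⟨T₁, hT₁, hT₁'⟩ := exists_backward_shift_powSeq hp
  obtain ⟨T₂, hT₂, -⟩ := exists_backward_shift_powSeq (add_pos hp two_pos)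
  obtain ⟨D, hD⟩ := exists_map_powSeq_add_two hp
  let e := WithLp.prodContinuousLinearEquiv 2 ℂ (lp (fun _ : ℕ => ℂ) 2) (lp (fun _ : ℕ => ℂ) 2)
  refine ⟨e.symm.toContinuousLinearMap ∘L
    ((T₁ ∘L .fst ℂ _ _ - ((t / s : ℝ) : ℂ) • (D ∘L .snd ℂ _ _)).prod (T₂ ∘L .snd ℂ _ _)) ∘L
      e.toContinuousLinearMap, fun z v => ?_⟩
  have hs' : (s : ℂ) ≠ 0 := Complex.ofReal_ne_zero.2 hs
  have hts : ((t / s : ℝ) : ℂ) * s = t := by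
    push_cast
    field_simp
  rw [jetFeature_apply]
  apply e.injective
  ext1
  · simp only [e, ContinuousLinearMap.comp_apply, ContinuousLinearEquiv.coe_coe,
      ContinuousLinearEquiv.apply_symm_apply, map_smul, ContinuousLinearMap.prod_apply,
      WithLp.prodContinuousLinearEquiv_apply, FunLike.coe_sub, Pi.sub_apply, FunLike.coe_smul,
      Pi.smul_apply, ContinuousLinearMap.coe_fst', ContinuousLinearMap.coe_snd', map_add, hT₁,
      hT₁', hD, Prod.smul_mk]
    rw [smul_comm _ (v 1), smul_smul _ (s : ℂ), hts]
    module
  · simp only [e, ContinuousLinearMap.comp_apply, ContinuousLinearEquiv.coe_coe,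
      ContinuousLinearEquiv.apply_symm_apply, map_smul, ContinuousLinearMap.prod_apply,
      WithLp.prodContinuousLinearEquiv_apply, ContinuousLinearMap.coe_snd', hT₂, Prod.smul_mk]
    module

/-- The element of the model that represents `z ↦ (zⁿ⁺¹, (t (n + 1) + y) zⁿ)`. -/
noncomputable def monomialPair (n : ℕ) (y : ℝ) : L2Pair :=
  WithLp.toLp 2 (lp.single 2 (n + 1) (((√(negBinomCoeff p (n + 1)))⁻¹ : ℝ) : ℂ),
    lp.single 2 n ((y / (s * √(negBinomCoeff (p + 2) n)) : ℝ) : ℂ))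

lemma inner_jetFeature_monomialPair (hs : s ≠ 0) (z : UnitDisc) (v : EuclideanSpace ℂ (Fin 2))
    (n : ℕ) (y : ℝ) :
    ⟪jetFeature hp t s z v, monomialPair (p := p) s n y⟫_ℂ =
      conj (v 0) * (z : ℂ) ^ (n + 1) + conj (v 1) * ((t * (n + 1) + y) * (z : ℂ) ^ n) := by
  have h1 := sqrt_negBinomCoeff_ne_zero hp (n + 1)
  have h2 := sqrt_negBinomCoeff_ne_zero (add_pos hp two_pos) n
  have hs' : (s : ℂ) ≠ 0 := Complex.ofReal_ne_zero.2 hs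
  rw [inner_jetFeature, monomialPair]
  simp only [WithLp.toLp_fst, WithLp.toLp_snd, lp.inner_single_right, RCLike.inner_apply',
    powSeq_apply, powDerivSeq_apply, map_mul, map_pow, Complex.conj_ofReal, Complex.conj_conj,
    Complex.conj_natCast, Nat.add_sub_cancel]
  push_cast
  field_simp

lemma inner_monomialPair_left (n : ℕ) (y : ℝ) (x : L2Pair) :
    ⟪monomialPair (p := p) s n y, x⟫_ℂ =
      ((√(negBinomCoeff p (n + 1)))⁻¹ : ℝ) * x.fst (n + 1) +
        (y / (s * √(negBinomCoeff (p + 2) n)) : ℝ) * x.snd n := by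
  rw [monomialPair, L2Pair.inner_def]
  simp only [WithLp.toLp_fst, WithLp.toLp_snd, lp.inner_single_left, RCLike.inner_apply',
    Complex.conj_ofReal]

lemma inner_monomialPair_self (hp : 0 < p) (n : ℕ) (y y' : ℝ) :
    ⟪monomialPair (p := p) s n y, monomialPair (p := p) s n y'⟫_ℂ =
      ((1 / negBinomCoeff p (n + 1) + y * y' / (s ^ 2 * negBinomCoeff (p + 2) n) : ℝ) : ℂ) := by
  rw [inner_monomialPair_left, monomialPair, WithLp.toLp_fst, WithLp.toLp_snd,
    lp.single_apply_self, lp.single_apply_self]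
  rw [← Complex.ofReal_mul, ← Complex.ofReal_mul, ← Complex.ofReal_add]
  congr 2
  · rw [← mul_inv, Real.mul_self_sqrt (negBinomCoeff_pos hp _).le, one_div]
  · rw [div_mul_div_comm, mul_mul_mul_comm s,
      Real.mul_self_sqrt (negBinomCoeff_pos (add_pos hp two_pos) _).le, sq]

lemma inner_monomialPair_of_ne {m n : ℕ} (h : m ≠ n) (y y' : ℝ) :
    ⟪monomialPair (p := p) s m y, monomialPair (p := p) s n y'⟫_ℂ = 0 := by
  rw [inner_monomialPair_left, monomialPair, WithLp.toLp_fst, WithLp.toLp_snd,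
    lp.single_apply_ne _ _ _ h, lp.single_apply_ne _ _ _ (by omega : m + 1 ≠ n + 1), mul_zero,
    mul_zero, add_zero]

end Model

/-! ### The Gram matrix of monomials and irreducibility. -/

section Bidisc

open Complex (UnitDisc)

variable {α β : ℝ} (hα : 0 < α) (hβ : 0 < β)

/-- The feature map of the diagonal jet kernel of `B^{(α,β)}`. -/
noncomputable abbrev bidiscFeature (z : UnitDisc) : EuclideanSpace ℂ (Fin 2) →L[ℂ] L2Pair :=
  jetFeature (add_pos hα hβ) (β / (α + β)) (√(α * β / (α + β))) z

lemma sqrt_div_add_pos (hα : 0 < α) (hβ : 0 < β) : 0 < √(α * β / (α + β)) := by positivity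

/-- The parameters are forced: off the diagonal `t p = β`, and in the lower corner `t² p (1 + p z
w̄) + s² = β (1 + β z w̄)`. -/
lemma inner_bidiscFeature (z w : UnitDisc) (u v : EuclideanSpace ℂ (Fin 2)) :
    ⟪bidiscFeature hα hβ z u, bidiscFeature hα hβ w v⟫_ℂ =
      ⟪u, diagJetKernel 2 (bidiscKernel α β) z w v⟫_ℂ := by
  have hp : (α : ℂ) + β ≠ 0 := by exact_mod_cast (add_pos hα hβ).ne'
  have hs : ((√(α * β / (α + β)) : ℝ) : ℂ) * (√(α * β / (α + β)) : ℝ) =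
      α * β / (α + β) := by
    exact_mod_cast Real.mul_self_sqrt (by positivity : 0 ≤ α * β / (α + β))
  rw [inner_jetFeature, jetFeature_apply, WithLp.toLp_fst, WithLp.toLp_snd]
  simp only [inner_add_right, inner_smul_right, inner_powSeq_powSeq, inner_powSeq_powDerivSeq,
    inner_powDerivSeq_powSeq, inner_powDerivSeq_powDerivSeq]
  rw [PiLp.inner_apply, Fin.sum_univ_two, diagJetKernel, Matrix.of_apply,
    Matrix.ofLp_toEuclideanCLM, jetMatrix_bidiscKernel α β z.norm_lt_one w.norm_lt_one]
  simp only [Matrix.mulVec, dotProduct, Fin.sum_univ_two, RCLike.inner_apply', Matrix.of_apply,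
    Matrix.cons_val_zero, Matrix.cons_val_one]
  generalize (1 - (z : ℂ) * conj (w : ℂ)) ^ (-((α + β : ℝ) : ℂ)) = A
  generalize (1 - (z : ℂ) * conj (w : ℂ)) ^ (-((α + β + 1 : ℝ) : ℂ)) = B
  generalize (1 - (z : ℂ) * conj (w : ℂ)) ^ (-((α + β + 2 : ℝ) : ℂ)) = C
  have key : (conj (u 1) * v 1 * C) * ((√(α * β / (α + β)) : ℝ) * (√(α * β / (α + β)) : ℝ)) =
    (conj (u 1) * v 1 * C) * (α * β / (α + β)) := by rw [hs]
  push_cast at key ⊢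
  rw [← sub_eq_zero]
  field_simp at key ⊢
  linear_combination key

lemma adjoint_bidiscFeature_comp (z w : UnitDisc) :
    ContinuousLinearMap.adjoint (bidiscFeature hα hβ z) ∘L bidiscFeature hα hβ w =
      diagJetKernel 2 (bidiscKernel α β) z w := by
  ext1 v
  refine ext_inner_left ℂ fun u => ?_
  rw [ContinuousLinearMap.comp_apply, ContinuousLinearMap.adjoint_inner_right,
    inner_bidiscFeature]

lemma eq_zero_of_forall_inner_bidiscFeature {x : L2Pair}
    (h : ∀ z v, ⟪bidiscFeature hα hβ z v, x⟫_ℂ = 0) : x = 0 :=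
  eq_zero_of_forall_inner_jetFeature _ _ _ (sqrt_div_add_pos hα hβ).ne' h

lemma eq_zero_of_forall_adjoint_bidiscFeature (x : L2Pair)
    (h : ∀ z, ContinuousLinearMap.adjoint (bidiscFeature hα hβ z) x = 0) : x = 0 :=
  eq_zero_of_forall_inner_bidiscFeature hα hβ fun z v => by
    rw [← ContinuousLinearMap.adjoint_inner_right, h, inner_zero_right]

/-- The element of the model that represents `z ↦ (zⁿ, 0)`. -/
noncomputable def firstMonomial (α β : ℝ) : ℕ → L2Pair
  | 0 => WithLp.toLp 2 (lp.single 2 0 1, 0)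
  | n + 1 => monomialPair (p := α + β) (√(α * β / (α + β))) n (-(β / (α + β) * (n + 1)))

/-- The element of the model that represents `z ↦ (zⁿ⁺¹, zⁿ)`. -/
noncomputable def mixedMonomial (α β : ℝ) (n : ℕ) : L2Pair :=
  monomialPair (p := α + β) (√(α * β / (α + β))) n (1 - β / (α + β) * (n + 1))

lemma inner_firstMonomial_zero (x : L2Pair) : ⟪firstMonomial α β 0, x⟫_ℂ = x.fst 0 := by
  rw [firstMonomial, L2Pair.inner_def, WithLp.toLp_fst, WithLp.toLp_snd, lp.inner_single_left,
    inner_zero_left, add_zero, RCLike.inner_apply', map_one, one_mul]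

lemma inner_bidiscFeature_firstMonomial (z : UnitDisc) (v : EuclideanSpace ℂ (Fin 2)) (n : ℕ) :
    ⟪bidiscFeature hα hβ z v, firstMonomial α β n⟫_ℂ = conj (v 0) * (z : ℂ) ^ n := by
  rcases n with _ | n
  · rw [← inner_conj_symm, inner_firstMonomial_zero, jetFeature_apply, WithLp.toLp_fst]
    rw [lp.coeFn_add, Pi.add_apply, lp.coeFn_smul, lp.coeFn_smul, lp.coeFn_smul, Pi.smul_apply,
      Pi.smul_apply, Pi.smul_apply, powSeq_apply, powDerivSeq_apply]
    simp
  · rw [firstMonomial, inner_jetFeature_monomialPair _ _ _ (sqrt_div_add_pos hα hβ).ne']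
    push_cast
    ring

lemma inner_bidiscFeature_mixedMonomial (z : UnitDisc) (v : EuclideanSpace ℂ (Fin 2)) (n : ℕ) :
    ⟪bidiscFeature hα hβ z v, mixedMonomial α β n⟫_ℂ =
      conj (v 0) * (z : ℂ) ^ (n + 1) + conj (v 1) * (z : ℂ) ^ n := by
  rw [mixedMonomial, inner_jetFeature_monomialPair _ _ _ (sqrt_div_add_pos hα hβ).ne']
  push_cast
  ring

/-- Being a kernel function at `0`, this vector is orthogonal to every multiple `z f`. The same
purpose is served by `smul_mixedMonomial_zero_eq`. -/
lemma firstMonomial_zero_eq :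
    firstMonomial α β 0 = bidiscFeature hα hβ 0 (EuclideanSpace.single 0 1) := by
  refine sub_eq_zero.1 (eq_zero_of_forall_inner_bidiscFeature hα hβ fun z v => ?_)
  rw [inner_sub_right, inner_bidiscFeature_firstMonomial, inner_bidiscFeature, diagJetKernel,
    Matrix.of_apply, PiLp.inner_apply, Fin.sum_univ_two, Matrix.ofLp_toEuclideanCLM,
    jetMatrix_bidiscKernel α β z.norm_lt_one (0 : UnitDisc).norm_lt_one]
  simp [Matrix.mulVec, dotProduct]

lemma smul_mixedMonomial_zero_eq :
    (β : ℂ) • mixedMonomial α β 0 = bidiscFeature hα hβ 0 (EuclideanSpace.single 1 1) := by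
  refine sub_eq_zero.1 (eq_zero_of_forall_inner_bidiscFeature hα hβ fun z v => ?_)
  rw [inner_sub_right, inner_smul_right, inner_bidiscFeature_mixedMonomial, inner_bidiscFeature,
    diagJetKernel, Matrix.of_apply, PiLp.inner_apply, Fin.sum_univ_two,
    Matrix.ofLp_toEuclideanCLM,
    jetMatrix_bidiscKernel α β z.norm_lt_one (0 : UnitDisc).norm_lt_one]
  simp [Matrix.mulVec, dotProduct]
  ring

lemma eq_zero_of_inner_monomials (hα : 0 < α) (hβ : 0 < β) (x : L2Pair)
    (h₁ : ∀ n, ⟪firstMonomial α β n, x⟫_ℂ = 0) (h₂ : ∀ n, ⟪mixedMonomial α β n, x⟫_ℂ = 0) :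
    x = 0 := by
  have hp := add_pos hα hβ
  have hs : ((√(α * β / (α + β)) : ℝ) : ℂ) ≠ 0 :=
    Complex.ofReal_ne_zero.2 (sqrt_div_add_pos hα hβ).ne'
  have hsnd : ∀ n, x.snd n = 0 := by
    intro n
    have e1 := h₁ (n + 1)
    have e2 := h₂ n
    rw [firstMonomial, inner_monomialPair_left] at e1
    rw [mixedMonomial, inner_monomialPair_left] at e2
    have hb := sqrt_negBinomCoeff_ne_zero (add_pos hp two_pos) n
    -- The vectors `rₙ` and `pₙ₊₁` share their first component, so their difference isolates the
    -- second coordinate.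
    have : (1 / (√(α * β / (α + β)) * √(negBinomCoeff (α + β + 2) n) : ℝ) : ℂ) * x.snd n = 0 := by
      push_cast at e1 e2 ⊢
      linear_combination e2 - e1
    refine (mul_eq_zero.1 this).resolve_left ?_
    push_cast
    exact one_div_ne_zero (mul_ne_zero hs hb)
  have hfst : ∀ n, x.fst n = 0 := by
    rintro (_ | n)
    · rw [← inner_firstMonomial_zero (α := α) (β := β), h₁]
    · have e1 := h₁ (n + 1)
      rw [firstMonomial, inner_monomialPair_left, hsnd, mul_zero, add_zero] at e1
      refine (mul_eq_zero.1 e1).resolve_left ?_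
      rw [Complex.ofReal_inv]
      exact inv_ne_zero (sqrt_negBinomCoeff_ne_zero hp _)
  apply (WithLp.equiv 2 _).injective
  ext n
  · exact hfst n
  · exact hsnd n

lemma inner_mixedMonomial_self (hα : 0 < α) (hβ : 0 < β) :
    ⟪mixedMonomial α β 0, mixedMonomial α β 0⟫_ℂ = ((1 / β : ℝ) : ℂ) := by
  have hp := add_pos hα hβ
  rw [mixedMonomial, inner_monomialPair_self _ hp, Real.sq_sqrt (by positivity)]
  congr 1
  simp only [negBinomCoeff_succ, negBinomCoeff_zero]
  push_cast
  field_simp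
  ring

lemma inner_firstMonomial_self (hα : 0 < α) (hβ : 0 < β) :
    ⟪firstMonomial α β 1, firstMonomial α β 1⟫_ℂ = ((1 / α : ℝ) : ℂ) := by
  have hp := add_pos hα hβ
  rw [firstMonomial, inner_monomialPair_self _ hp, Real.sq_sqrt (by positivity)]
  congr 1
  simp only [negBinomCoeff_succ, negBinomCoeff_zero]
  push_cast
  field_simp
  ring

/-- Here `‖p₀‖ = 1` and `‖p₁‖² ‖r₀‖² = 1/(αβ)`, which strictly exceeds `‖r₁‖²`: the difference is a
positive multiple of `α + β + 1 + αβ`. -/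
lemma inner_monomials_gram_ne (hα : 0 < α) (hβ : 0 < β) :
    ⟪firstMonomial α β 1, firstMonomial α β 1⟫_ℂ * ⟪mixedMonomial α β 0, mixedMonomial α β 0⟫_ℂ ≠
      ⟪firstMonomial α β 0, firstMonomial α β 0⟫_ℂ *
        ⟪mixedMonomial α β 1, mixedMonomial α β 1⟫_ℂ := by
  have hp := add_pos hα hβ
  have h0 : ⟪firstMonomial α β 0, firstMonomial α β 0⟫_ℂ = ((1 : ℝ) : ℂ) := by
    rw [inner_firstMonomial_zero, firstMonomial, WithLp.toLp_fst, lp.single_apply_self]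
    norm_num
  rw [inner_mixedMonomial_self hα hβ, inner_firstMonomial_self hα hβ, h0, mixedMonomial,
    inner_monomialPair_self _ hp, Real.sq_sqrt (by positivity), ← Complex.ofReal_mul,
    ← Complex.ofReal_mul, Complex.ofReal_injective.ne_iff]
  simp only [negBinomCoeff_succ, negBinomCoeff_zero]
  push_cast
  intro h
  field_simp at h
  have hpos : 0 < 2 * (α + β) ^ 2 * (α + β + 1 + α * β) := by positivity
  exact hpos.ne' (by linear_combination h)

lemma inner_firstMonomial_two_mixedMonomial_one_ne (hα : 0 < α) (hβ : 0 < β) :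
    ⟪firstMonomial α β 2, mixedMonomial α β 1⟫_ℂ ≠ 0 := by
  have hp := add_pos hα hβ
  rw [firstMonomial, mixedMonomial, inner_monomialPair_self _ hp, Real.sq_sqrt (by positivity),
    Complex.ofReal_ne_zero]
  simp only [negBinomCoeff_succ, negBinomCoeff_zero]
  push_cast
  intro h
  field_simp at h
  have hpos : 0 < 2 * (α + β) * (α + β * (α + β) + β) := by positivity
  exact hpos.ne' (by linear_combination h)

lemma inner_firstMonomial_mixedMonomial_zero :
    ⟪firstMonomial α β 0, mixedMonomial α β 0⟫_ℂ = 0 := by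
  rw [inner_firstMonomial_zero, mixedMonomial, monomialPair, WithLp.toLp_fst,
    lp.single_apply_ne _ _ _ (by norm_num)]

lemma exists_multiplication_clm {H : Type*} [NormedAddCommGroup H] [InnerProductSpace ℂ H]
    [CompleteSpace H] [RKHS ℂ H UnitDisc (EuclideanSpace ℂ (Fin 2))] (hα : 0 < α) (hβ : 0 < β)
    (hK : RKHS.kernel H = diagJetKernel 2 (bidiscKernel α β)) :
    ∃ M : H →L[ℂ] H, (∀ (f : H) (z : UnitDisc), M f z = (z : ℂ) • f z) ∧
      IsIrreducibleOperator (ContinuousLinearMap.adjoint M) := by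
  obtain ⟨U, hU⟩ := RKHS.exists_linearIsometryEquiv_feature (H := H) (bidiscFeature hα hβ)
    (eq_zero_of_forall_adjoint_bidiscFeature hα hβ)
    (fun z w => by rw [hK, adjoint_bidiscFeature_comp])
  obtain ⟨N, hN⟩ := exists_clm_jetFeature_eigenvector (add_pos hα hβ) (β / (α + β))
    (√(α * β / (α + β))) (sqrt_div_add_pos hα hβ).ne'
  have hT : ∀ z v x, ⟪bidiscFeature hα hβ z v, ContinuousLinearMap.adjoint N x⟫_ℂ =
      z * ⟪bidiscFeature hα hβ z v, x⟫_ℂ := by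
    intro z v x
    rw [ContinuousLinearMap.adjoint_inner_right, hN, inner_smul_left, Complex.conj_conj]
  have hT0 : ∀ v x, ⟪bidiscFeature hα hβ 0 v, ContinuousLinearMap.adjoint N x⟫_ℂ = 0 := by
    intro v x
    rw [hT, UnitDisc.coe_zero, zero_mul]
  -- The adjoint of `N` acts as multiplication by `z` in the model, and `U` carries it to `H`.
  let M : H →L[ℂ] H := (U.symm : L2Pair →L[ℂ] H) ∘L ContinuousLinearMap.adjoint N ∘L
    (U : H →L[ℂ] L2Pair)
  have hM : ∀ f, M f = U.symm (ContinuousLinearMap.adjoint N (U f)) := fun f => rfl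
  refine ⟨M, fun f z => ext_inner_left ℂ fun v => ?_, ?_⟩
  · rw [← RKHS.kerFun_inner, ← U.inner_map_map, hU, hM, U.apply_symm_apply, hT, ← hU,
      U.inner_map_map, RKHS.kerFun_inner, inner_smul_right]
  refine isIrreducibleOperator_adjoint_of_shift M (fun n => U.symm (firstMonomial α β n))
    (fun n => U.symm (mixedMonomial α β n)) (fun n => ?_) (fun n => ?_) (fun f h₁ h₂ => ?_)
    (fun f => ?_) (fun f => ?_) ?_ ?_ ?_ ?_
  · rw [hM, U.apply_symm_apply]
    refine congrArg U.symm (sub_eq_zero.1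
      (eq_zero_of_forall_inner_bidiscFeature hα hβ fun z v => ?_))
    rw [inner_sub_right, hT, inner_bidiscFeature_firstMonomial, inner_bidiscFeature_firstMonomial]
    ring
  · rw [hM, U.apply_symm_apply]
    refine congrArg U.symm (sub_eq_zero.1
      (eq_zero_of_forall_inner_bidiscFeature hα hβ fun z v => ?_))
    rw [inner_sub_right, hT, inner_bidiscFeature_mixedMonomial, inner_bidiscFeature_mixedMonomial]
    ring
  · rw [← U.map_eq_zero_iff]
    refine eq_zero_of_inner_monomials hα hβ _ (fun n => ?_) fun n => ?_
    · rw [← U.symm.inner_map_map, U.symm_apply_apply, h₁]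
    · rw [← U.symm.inner_map_map, U.symm_apply_apply, h₂]
  · rw [hM, U.symm.inner_map_map, firstMonomial_zero_eq hα hβ, hT0]
  · have h := hT0 (EuclideanSpace.single 1 1) (U f)
    rw [← smul_mixedMonomial_zero_eq, inner_smul_left, Complex.conj_ofReal] at h
    rw [hM, U.symm.inner_map_map]
    exact (mul_eq_zero.1 h).resolve_left (Complex.ofReal_ne_zero.2 hβ.ne')
  · rw [U.symm.inner_map_map, inner_firstMonomial_mixedMonomial_zero]
  · rw [U.symm.inner_map_map]
    exact inner_monomialPair_of_ne _ zero_ne_one _ _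
  · simp only [U.symm.inner_map_map]
    exact inner_monomials_gram_ne hα hβ
  · rw [U.symm.inner_map_map]
    exact inner_firstMonomial_two_mixedMonomial_one_ne hα hβ

end Bidisc

theorem mainTheorem6 (α β : ℝ) (hα : 0 < α) (hβ : 0 < β) :
    (∃ (H : Type) (_ : NormedAddCommGroup H) (_ : InnerProductSpace ℂ H) (_ : CompleteSpace H)
      (_ : RKHS ℂ H Complex.UnitDisc (EuclideanSpace ℂ (Fin 2))),
      RKHS.kernel H = diagJetKernel 2 (bidiscKernel α β)) ∧
    ∀ (H : Type*) [NormedAddCommGroup H] [InnerProductSpace ℂ H] [CompleteSpace H]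
      [RKHS ℂ H Complex.UnitDisc (EuclideanSpace ℂ (Fin 2))],
      RKHS.kernel H = diagJetKernel 2 (bidiscKernel α β) →
      ∃ M : H →L[ℂ] H,
        (∀ (f : H) (z : Complex.UnitDisc), M f z = (z : ℂ) • f z) ∧
        IsIrreducibleOperator (ContinuousLinearMap.adjoint M) := by
  refine ⟨⟨L2Pair, inferInstance, inferInstance, inferInstance,
    RKHS.ofFeature (bidiscFeature hα hβ) (eq_zero_of_forall_adjoint_bidiscFeature hα hβ), ?_⟩,
    fun H _ _ _ _ hK => exists_multiplication_clm hα hβ hK⟩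
  ext1 z w
  exact (RKHS.kernel_ofFeature _ _ z w).trans (adjoint_bidiscFeature_comp hα hβ z w)
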